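/- Let $X$ be a uniformly convex (real) Banach space and let $M, N$ be nonempty bounded closed convex subsets of $X$. Put $d(M,N)=\inf\{\|w-z\| : w\in M,\ z\in N\}$ and $M_0=\{w\in M : \|w-z'\|=d(M,N)\text{ for some } z'\in N\}$. Let $F: M\cup N\to M\cup N$ satisfy 1. $F(M)\subseteq M$ and $F(N)\subseteq N$; 2. $\|Fw-Fz\|\le\|w-z\|$ for all $w\in M$ and $z\in N$. Let $\epsilon\in(0,1/2)$, let $\eta_n,\delta_n\in(\epsilon,1-\epsilon)$ for $n=0,1,2,\dots$, let $w_0\in M$, and define $$w_{n+1}=(1-\eta_n)w_n+\eta_n F\big((1-\delta_n)w_n+\delta_n Fw_n\big),\qquad n=0,1,2,\dots$$ Suppose that $d(w_n,M_0)\to 0$, where $d(w,M_0)=\inf_{a\in M_0}\|w-a\|$. Then $\lim_{n\to\infty}\|w_n-Fw_n\|=0$. Moreover, if $F(M)$ lies in a compact set, then $\{w_n\}$ converges to a fixed point of $F$. -/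

import Mathlib

/-- The distance between two sets, `d(M, N) = inf {‖w - z‖ : w ∈ M, z ∈ N}`
(used for nonempty `M` and `N`, where the infimum is a genuine one). -/
noncomputable def setGap {X : Type*} [NormedAddCommGroup X] (M N : Set X) : ℝ :=
  sInf {r : ℝ | ∃ w ∈ M, ∃ z ∈ N, r = ‖w - z‖}

/-- The proximal set `M₀ = {w ∈ M : ‖w - z'‖ = d(M, N) for some z' ∈ N}`. -/
def proximalSet {X : Type*} [NormedAddCommGroup X] (M N : Set X) : Set X :=
  {w | w ∈ M ∧ ∃ z' ∈ N, ‖w - z'‖ = setGap M N}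

/-- `F` is relatively nonexpansive with respect to `(M, N)`:
`‖F w - F z‖ ≤ ‖w - z‖` for all `w ∈ M` and `z ∈ N` (nothing is required for two points
of the same set). Only the values of `F` on `M ∪ N` matter. -/
def RelativelyNonexpansive {X : Type*} [NormedAddCommGroup X] (F : X → X) (M N : Set X) : Prop :=
  ∀ w ∈ M, ∀ z ∈ N, ‖F w - F z‖ ≤ ‖w - z‖

/-- The Ishikawa iteration of `F` with parameters `η`, `δ`, started at `w₀`:
`w (n+1) = (1 - η n) w n + η n F ((1 - δ n) w n + δ n F (w n))`. -/
def ishikawaSeq {X : Type*} [NormedAddCommGroup X] [NormedSpace ℝ X]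
    (F : X → X) (η δ : ℕ → ℝ) (w₀ : X) : ℕ → X
  | 0 => w₀
  | n + 1 =>
    (1 - η n) • ishikawaSeq F η δ w₀ n +
      η n • F ((1 - δ n) • ishikawaSeq F η δ w₀ n + δ n • F (ishikawaSeq F η δ w₀ n))

/-!
The proof rests on a quantitative form of uniform convexity
(`exists_pos_dist_lt_of_lt_norm_combo_sub`): if `x` and `y` both lie within about `r` of a point
`c`, and some convex combination of them, with coefficients bounded away from `0`, is not much
closer to `c` than `r`, then `x` and `y` are close to each other.

*Fixed points.* The asymptotic centre `c` in `N` of the orbit `n ↦ Fⁿ w₀` in `M` is unique. As `F`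
shifts the orbit and does not increase distances between `M` and `N`, the point `F c` is also an
asymptotic centre, so `F c = c`. Thus `F` has a fixed point `q ∈ N`.

*Asymptotic regularity.* For a fixed point `q ∈ N`, both steps of the iteration do not increase
the distance to `q`, hence `‖wₙ - q‖` decreases to some `r`. The intermediate points
`(1 - δₙ) wₙ + δₙ F wₙ` are then also asymptotically at distance `r` from `q`, while `wₙ` and
`F wₙ` are at distance at most `‖wₙ - q‖`; uniform convexity forces `‖wₙ - F wₙ‖ → 0`.

*Convergence.* If `F(M)` is relatively compact, then `wₙ` has a cluster point `p`, also a
cluster point of `F wₙ`. The proximal set is nonempty and closed, so `p` has a nearest point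
`p' ∈ N` at distance `d(M, N)`. Comparing `F wₙ` with `F p'` gives `‖p - F p'‖ ≤ d(M, N)`, so
`F p' = p'` by uniqueness of nearest points, and then `F p = p`. Now `‖wₙ - p'‖` is decreasing and
tends to `d(M, N)` along a subsequence, so it tends to `d(M, N)`, and uniform convexity gives
`wₙ → p`. The nonemptiness of the proximal set comes from the fact that decreasing sequences of
bounded closed convex sets in `X` have common points; their almost minimal elements form a Cauchy
sequence, so that reflexivity of `X` is not needed.
-/

open Filter Topology Metric

/-! ### Uniform convexity -/

section UniformConvexity

variable {X : Type*} [NormedAddCommGroup X] [NormedSpace ℝ X] [UniformConvexSpace X]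

/-- The modulus of `exists_forall_closed_ball_dist_add_le_two_mul_sub`, made stable under a small
enlargement of the radius `r`. -/
theorem exists_pos_norm_add_le_of_norm_le_add {r e : ℝ} (hr : 0 ≤ r) (he : 0 < e) :
    ∃ s > 0, ∀ x y : X, ‖x‖ ≤ r + s → ‖y‖ ≤ r + s → e ≤ ‖x - y‖ → ‖x + y‖ ≤ 2 * r - s := by
  rcases hr.eq_or_lt with rfl | hr
  · refine ⟨e / 4, by positivity, fun x y hx hy hxy => ?_⟩
    have := norm_sub_le x y
    linarith
  obtain ⟨d, hd, h⟩ := exists_forall_closed_ball_dist_add_le_two_mul_sub X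
    (half_pos he) r
  refine ⟨min r (d / 3), by positivity, fun x y hx hy hxy => ?_⟩
  set s := min r (d / 3)
  have hs : 0 < s := by positivity
  have hsr : s ≤ r := min_le_left _ _
  have hsd : s ≤ d / 3 := min_le_right _ _
  -- Rescale the ball of radius `r + s` to the ball of radius `r`.
  set k := r / (r + s)
  have hk0 : 0 ≤ k := by positivity
  have hkm : k * (r + s) = r := div_mul_cancel₀ _ (by positivity)
  have hk2 : 1 / 2 ≤ k := by
    rw [div_le_div_iff₀ (by norm_num) (by positivity)]
    linarith
  have hk1 : k ≤ 1 := div_le_one_of_le₀ (by linarith) (by positivity)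
  have scale : ∀ z : X, ‖k • z‖ = k * ‖z‖ := fun z => norm_smul_of_nonneg hk0 z
  have hb : ∀ z : X, ‖z‖ ≤ r + s → ‖k • z‖ ≤ r := fun z hz => by
    rw [scale]
    calc k * ‖z‖ ≤ k * (r + s) := by gcongr
      _ = r := hkm
  have h1 := h (hb x hx) (hb y hy) (by
    rw [← smul_sub, scale]
    nlinarith)
  rw [← smul_add, scale] at h1
  have h2 : ‖x + y‖ ≤ 2 * (r + s) := (norm_add_le x y).trans (by linarith)
  have h3 : (1 - k) * ‖x + y‖ ≤ (1 - k) * (2 * (r + s)) :=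
    mul_le_mul_of_nonneg_left h2 (by linarith)
  have h4 : (1 - k) * (2 * (r + s)) = 2 * s := by linear_combination (-2) * hkm
  linarith

/-- If `x` and `y` are within about `r` of `c`, and a convex combination of them with coefficients
at least `a` is not much closer to `c` than `r`, then `x` and `y` are close to each other. The
tolerance `s` does not depend on `c`. -/
theorem exists_pos_dist_lt_of_lt_norm_combo_sub {r a e : ℝ} (hr : 0 ≤ r) (ha : 0 < a)
    (he : 0 < e) :
    ∃ s > 0, ∀ (c x y : X) (t : ℝ), a ≤ t → t ≤ 1 - a → ‖x - c‖ ≤ r + s → ‖y - c‖ ≤ r + s →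
      r - s < ‖(1 - t) • x + t • y - c‖ → dist x y < e := by
  obtain ⟨d, hd, h⟩ := exists_pos_norm_add_le_of_norm_le_add (X := X) hr he
  have hs0 : 0 < min d (a * d / 2) := by positivity
  refine ⟨min d (a * d / 2), hs0, fun c x y t hta hta1 hx hy hxy => ?_⟩
  set s := min d (a * d / 2)
  have hsd : s ≤ d := min_le_left _ _
  have hsa : s ≤ a * d / 2 := min_le_right _ _
  by_contra! hcon
  rw [dist_eq_norm] at hcon
  have key := h (x - c) (y - c) (by linarith) (by linarith) (by simpa using hcon)
  refine absurd hxy (not_lt.2 ?_)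
  -- Split off the multiple of `x + y` that uses up the smaller of the two coefficients.
  rcases le_total t (1 / 2) with ht | ht
  · have e1 : (1 - t) • x + t • y - c
        = (1 - 2 * t) • (x - c) + t • ((x - c) + (y - c)) := by module
    rw [e1]
    refine (norm_add_le _ _).trans ?_
    rw [norm_smul_of_nonneg (by linarith), norm_smul_of_nonneg (by linarith)]
    have h1 := mul_le_mul_of_nonneg_left hx (show 0 ≤ 1 - 2 * t by linarith)
    have h2 := mul_le_mul_of_nonneg_left key (show 0 ≤ t by linarith)
    nlinarith
  · have e1 : (1 - t) • x + t • y - c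
        = (2 * t - 1) • (y - c) + (1 - t) • ((x - c) + (y - c)) := by module
    rw [e1]
    refine (norm_add_le _ _).trans ?_
    rw [norm_smul_of_nonneg (by linarith), norm_smul_of_nonneg (by linarith)]
    have h1 := mul_le_mul_of_nonneg_left hy (show 0 ≤ 2 * t - 1 by linarith)
    have h2 := mul_le_mul_of_nonneg_left key (show 0 ≤ 1 - t by linarith)
    nlinarith

theorem exists_pos_dist_lt_of_lt_norm_midpoint_sub {r e : ℝ} (hr : 0 ≤ r) (he : 0 < e) :
    ∃ s > 0, ∀ c x y : X, ‖x - c‖ ≤ r + s → ‖y - c‖ ≤ r + s →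
      r - s < ‖midpoint ℝ x y - c‖ → dist x y < e := by
  obtain ⟨s, hs, h⟩ := exists_pos_dist_lt_of_lt_norm_combo_sub (X := X) hr
    (show (0 : ℝ) < 1 / 2 by norm_num) he
  refine ⟨s, hs, fun c x y hx hy hm =>
    h c x y (1 / 2) le_rfl (by norm_num) hx hy ?_⟩
  have : midpoint ℝ x y = (1 - 1 / 2 : ℝ) • x + (1 / 2 : ℝ) • y := by
    rw [midpoint_eq_smul_add, invOf_eq_inv]
    module
  rwa [← this]

/-- Nearest points in a convex set are unique. -/
theorem Convex.eq_of_norm_sub_le {N : Set X} (hN : Convex ℝ N) {p y z : X} {d : ℝ} (hd : 0 ≤ d)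
    (hy : y ∈ N) (hz : z ∈ N) (hyp : ‖y - p‖ ≤ d) (hzp : ‖z - p‖ ≤ d)
    (hmin : ∀ x ∈ N, d ≤ ‖x - p‖) : y = z := by
  refine eq_of_forall_dist_le fun e he => ?_
  obtain ⟨s, hs, h⟩ := exists_pos_dist_lt_of_lt_norm_midpoint_sub (X := X) hd he
  have := hmin _ (hN.midpoint_mem hy hz)
  exact (h p y z (by linarith) (by linarith) (by linarith)).le

variable [CompleteSpace X]

/-- A decreasing sequence of nonempty bounded closed convex sets has a common point: almost minimal
elements `y k` of `A k` form a Cauchy sequence. -/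
theorem exists_mem_forall_of_antitone_convex {A : ℕ → Set X} (hA : Antitone A)
    (hne : ∀ k, (A k).Nonempty) (hcl : ∀ k, IsClosed (A k)) (hcv : ∀ k, Convex ℝ (A k))
    (hb : Bornology.IsBounded (A 0)) : ∃ x, ∀ k, x ∈ A k := by
  obtain ⟨R, hR⟩ := hb.exists_norm_le
  let a : ℕ → ℝ := fun k => infDist 0 (A k)
  have ha_le : ∀ k, ∀ x ∈ A k, a k ≤ ‖x‖ := fun k x hx => by
    simpa using infDist_le_dist_of_mem (x := (0 : X)) hx
  have ha_mono : Monotone a := fun i j hij => infDist_le_infDist_of_subset (hA hij) (hne j)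
  have ha_bdd : BddAbove (Set.range a) := by
    refine ⟨R, ?_⟩
    rintro _ ⟨k, rfl⟩
    obtain ⟨x, hx⟩ := hne k
    exact (ha_le k x hx).trans (hR x (hA (Nat.zero_le k) hx))
  set r := ⨆ k, a k
  have har : ∀ k, a k ≤ r := le_ciSup ha_bdd
  have hr : 0 ≤ r := infDist_nonneg.trans (har 0)
  have hat : Tendsto a atTop (𝓝 r) := tendsto_atTop_ciSup ha_mono ha_bdd
  have hy : ∀ k : ℕ, ∃ y ∈ A k, ‖y‖ < a k + 1 / ((k : ℝ) + 1) := fun k => by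
    have hlt : infDist 0 (A k) < a k + 1 / ((k : ℝ) + 1) :=
      lt_add_of_pos_right _ Nat.one_div_pos_of_nat
    simpa using (infDist_lt_iff (hne k)).1 hlt
  choose y hyA hyn using hy
  have hcau : CauchySeq y := by
    refine Metric.cauchySeq_iff.2 fun e he => ?_
    obtain ⟨s, hs, h⟩ := exists_pos_dist_lt_of_lt_norm_midpoint_sub (X := X) hr he
    have h1 : ∀ᶠ k in atTop, r - s < a k := hat.eventually_const_lt (by linarith)
    have h2 : ∀ᶠ k : ℕ in atTop, 1 / ((k : ℝ) + 1) < s :=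
      tendsto_one_div_add_atTop_nhds_zero_nat.eventually_lt_const hs
    obtain ⟨K, hK⟩ := eventually_atTop.1 (h1.and h2)
    have hn : ∀ k ≥ K, ‖y k - 0‖ ≤ r + s := fun k hk => by
      rw [sub_zero]
      linarith [hyn k, har k, (hK k hk).2]
    refine ⟨K, fun i hi j hj => h 0 _ _ (hn i hi) (hn j hj) ?_⟩
    rw [sub_zero]
    exact (hK K le_rfl).1.trans_le
      (ha_le K _ ((hcv K).midpoint_mem (hA hi (hyA i)) (hA hj (hyA j))))
  obtain ⟨x, hx⟩ := cauchySeq_tendsto_of_complete hcau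
  exact ⟨x, fun k => (hcl k).mem_of_tendsto hx
    ((eventually_ge_atTop k).mono fun i hi => hA hi (hyA i))⟩

/-- Existence and uniqueness of the asymptotic centre `c` in `N` of a bounded sequence `x`; the
number `r` is the asymptotic radius, that is, the minimum of `limsup ‖z - x n‖` over `z ∈ N`. -/
theorem exists_asymptotic_center {N : Set X} (hne : N.Nonempty) (hcl : IsClosed N)
    (hcv : Convex ℝ N) {x : ℕ → X} (hx : Bornology.IsBounded (Set.range x)) :
    ∃ r : ℝ, ∃ c ∈ N, (∀ s > 0, ∀ᶠ n in atTop, ‖c - x n‖ ≤ r + s) ∧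
      ∀ z ∈ N, (∀ s > 0, ∀ᶠ n in atTop, ‖z - x n‖ ≤ r + s) → z = c := by
  let S : Set ℝ := {R | ∃ z ∈ N, ∀ᶠ n in atTop, ‖z - x n‖ ≤ R}
  have hS0 : ∀ R ∈ S, 0 ≤ R := by
    rintro R ⟨z, -, hz⟩
    obtain ⟨n, hn⟩ := hz.exists
    exact (norm_nonneg _).trans hn
  have hSb : BddBelow S := ⟨0, hS0⟩
  have hSne : S.Nonempty := by
    obtain ⟨z, hz⟩ := hne
    obtain ⟨R, hR⟩ := hx.exists_norm_le
    refine ⟨‖z‖ + R, z, hz, Eventually.of_forall fun n => (norm_sub_le _ _).trans ?_⟩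
    have := hR (x n) ⟨n, rfl⟩
    linarith
  set r := sInf S
  have hr : 0 ≤ r := le_csInf hSne hS0
  -- No point of `N` is eventually within less than `r` of the sequence, so two almost optimal
  -- points are close to each other.
  have close : ∀ e > 0, ∃ s > 0, ∀ z ∈ N, ∀ z' ∈ N, (∀ᶠ n in atTop, ‖z - x n‖ ≤ r + s) →
      (∀ᶠ n in atTop, ‖z' - x n‖ ≤ r + s) → dist z z' < e := fun e he => by
    obtain ⟨s, hs, h⟩ := exists_pos_dist_lt_of_lt_norm_midpoint_sub (X := X) hr he
    refine ⟨s, hs, fun z hz z' hz' h1 h2 => ?_⟩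
    have h3 : ∃ᶠ n in atTop, ¬ ‖midpoint ℝ z z' - x n‖ ≤ r - s := fun hcon => by
      have : r - s ∈ S := ⟨_, hcv.midpoint_mem hz hz', by simpa using hcon⟩
      linarith [csInf_le hSb this]
    obtain ⟨n, hn3, hn1, hn2⟩ := (h3.and_eventually (h1.and h2)).exists
    exact h (x n) z z' hn1 hn2 (not_le.1 hn3)
  have hy : ∀ k : ℕ, ∃ y ∈ N, ∀ᶠ n in atTop, ‖y - x n‖ ≤ r + 1 / ((k : ℝ) + 1) := fun k => by
    obtain ⟨R, ⟨y, hyN, hy⟩, hR⟩ := exists_lt_of_csInf_lt hSne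
      (show sInf S < r + 1 / ((k : ℝ) + 1) from lt_add_of_pos_right _ Nat.one_div_pos_of_nat)
    exact ⟨y, hyN, hy.mono fun n hn => hn.trans hR.le⟩
  choose y hyN hy using hy
  have hys : ∀ s > 0, ∀ᶠ k in atTop, ∀ᶠ n in atTop, ‖y k - x n‖ ≤ r + s := fun s hs => by
    filter_upwards [tendsto_one_div_add_atTop_nhds_zero_nat.eventually_lt_const hs] with k hk
    exact (hy k).mono fun n hn => by linarith
  have hcau : CauchySeq y := by
    refine Metric.cauchySeq_iff.2 fun e he => ?_
    obtain ⟨s, hs, h⟩ := close e he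
    obtain ⟨K, hK⟩ := eventually_atTop.1 (hys s hs)
    exact ⟨K, fun i hi j hj => h _ (hyN i) _ (hyN j) (hK i hi) (hK j hj)⟩
  obtain ⟨c, hc⟩ := cauchySeq_tendsto_of_complete hcau
  have hcN : c ∈ N := hcl.mem_of_tendsto hc (Eventually.of_forall hyN)
  have hcr : ∀ s > 0, ∀ᶠ n in atTop, ‖c - x n‖ ≤ r + s := fun s hs => by
    obtain ⟨k, hk1, hk2⟩ := ((hys (s / 2) (half_pos hs)).and
      (Metric.tendsto_nhds.1 hc (s / 2) (half_pos hs))).exists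
    filter_upwards [hk1] with n hn
    rw [dist_comm, dist_eq_norm] at hk2
    linarith [norm_sub_le_norm_sub_add_norm_sub c (y k) (x n)]
  refine ⟨r, c, hcN, hcr, fun z hz hzr => eq_of_forall_dist_le fun e he => ?_⟩
  obtain ⟨s, hs, h⟩ := close e he
  exact (h z hz c hcN (hzr s hs) (hcr s hs)).le

end UniformConvexity

/-! ### The gap and the proximal set -/

section Proximal

variable {X : Type*} [NormedAddCommGroup X] {M N : Set X}

theorem bddBelow_norm_sub (M N : Set X) :
    BddBelow {r : ℝ | ∃ w ∈ M, ∃ z ∈ N, r = ‖w - z‖} :=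
  ⟨0, by rintro _ ⟨w, -, z, -, rfl⟩; exact norm_nonneg _⟩

theorem setGap_le {w z : X} (hw : w ∈ M) (hz : z ∈ N) : setGap M N ≤ ‖w - z‖ :=
  csInf_le (bddBelow_norm_sub M N) ⟨w, hw, z, hz, rfl⟩

theorem setGap_nonneg (M N : Set X) : 0 ≤ setGap M N :=
  Real.sInf_nonneg (by rintro _ ⟨w, -, z, -, rfl⟩; exact norm_nonneg _)

theorem exists_norm_sub_lt_of_setGap_lt (hM : M.Nonempty) (hN : N.Nonempty) {R : ℝ}
    (hR : setGap M N < R) : ∃ w ∈ M, ∃ z ∈ N, ‖w - z‖ < R := by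
  obtain ⟨w, hw⟩ := hM
  obtain ⟨z, hz⟩ := hN
  obtain ⟨_, ⟨w', hw', z', hz', rfl⟩, h⟩ := exists_lt_of_csInf_lt
    (s := {r : ℝ | ∃ w ∈ M, ∃ z ∈ N, r = ‖w - z‖}) ⟨_, w, hw, z, hz, rfl⟩ hR
  exact ⟨w', hw', z', hz', h⟩

variable [NormedSpace ℝ X] [UniformConvexSpace X] [CompleteSpace X]

theorem antitone_const_add_one_div (d : ℝ) : Antitone fun k : ℕ => d + 1 / ((k : ℝ) + 1) :=
  fun _ _ hij => by
    have := Nat.one_div_le_one_div (α := ℝ) hij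
    linarith

/-- A bounded closed convex set `N` contains a point within `d` of `w` as soon as `w` lies in the
closed `d`-thickening of `N`. -/
theorem Convex.exists_norm_sub_le_of_mem_cthickening (hNb : Bornology.IsBounded N)
    (hNcl : IsClosed N) (hNcv : Convex ℝ N) {d : ℝ} (hd : 0 ≤ d) {w : X}
    (hw : w ∈ Metric.cthickening d N) : ∃ z ∈ N, ‖w - z‖ ≤ d := by
  obtain ⟨z, hz⟩ := exists_mem_forall_of_antitone_convex
    (A := fun k : ℕ => N ∩ closedBall w (d + 1 / ((k : ℝ) + 1)))
    (fun i j hij => Set.inter_subset_inter_right _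
      (closedBall_subset_closedBall (antitone_const_add_one_div d hij)))
    (fun k => by
      have hk : 0 < 1 / ((k : ℝ) + 1) := Nat.one_div_pos_of_nat
      obtain ⟨z, hz, hzw⟩ := mem_thickening_iff.1
        (cthickening_subset_thickening' (δ₂ := d + 1 / ((k : ℝ) + 1)) (by linarith)
          (by linarith) N hw)
      exact ⟨z, hz, by rw [mem_closedBall, dist_comm]; exact hzw.le⟩)
    (fun k => hNcl.inter isClosed_closedBall)
    (fun k => hNcv.inter (convex_closedBall _ _))
    (hNb.subset Set.inter_subset_left)
  refine ⟨z, (hz 0).1, le_of_tendsto_of_tendsto' tendsto_const_nhds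
    (by simpa using tendsto_one_div_add_atTop_nhds_zero_nat.const_add d) fun k => ?_⟩
  rw [← dist_eq_norm, dist_comm]
  simpa using (hz k).2

theorem proximalSet_eq_inter_cthickening (hNb : Bornology.IsBounded N) (hNcl : IsClosed N)
    (hNcv : Convex ℝ N) : proximalSet M N = M ∩ cthickening (setGap M N) N := by
  ext w
  constructor
  · rintro ⟨hw, z, hz, hwz⟩
    exact ⟨hw, mem_cthickening_of_dist_le w z _ N hz (by rw [dist_eq_norm, hwz])⟩
  · rintro ⟨hw, hwN⟩
    obtain ⟨z, hz, hwz⟩ :=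
      hNcv.exists_norm_sub_le_of_mem_cthickening hNb hNcl (setGap_nonneg M N) hwN
    exact ⟨hw, z, hz, hwz.antisymm (setGap_le hw hz)⟩

theorem isClosed_proximalSet (hMcl : IsClosed M) (hNb : Bornology.IsBounded N)
    (hNcl : IsClosed N) (hNcv : Convex ℝ N) : IsClosed (proximalSet M N) := by
  rw [proximalSet_eq_inter_cthickening hNb hNcl hNcv]
  exact hMcl.inter isClosed_cthickening

theorem proximalSet_nonempty (hMne : M.Nonempty) (hNne : N.Nonempty)
    (hMb : Bornology.IsBounded M) (hNb : Bornology.IsBounded N)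
    (hMcl : IsClosed M) (hNcl : IsClosed N) (hMcv : Convex ℝ M) (hNcv : Convex ℝ N) :
    (proximalSet M N).Nonempty := by
  have hd := setGap_nonneg M N
  obtain ⟨w, hw⟩ := exists_mem_forall_of_antitone_convex
    (A := fun k : ℕ => M ∩ cthickening (setGap M N + 1 / ((k : ℝ) + 1)) N)
    (fun i j hij => Set.inter_subset_inter_right _
      (cthickening_mono (antitone_const_add_one_div _ hij) N))
    (fun k => by
      obtain ⟨w, hw, z, hz, hwz⟩ := exists_norm_sub_lt_of_setGap_lt hMne hNne
        (lt_add_of_pos_right (setGap M N) (Nat.one_div_pos_of_nat (n := k)))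
      exact ⟨w, hw, mem_cthickening_of_dist_le w z _ N hz (by rw [dist_eq_norm]; exact hwz.le)⟩)
    (fun k => hMcl.inter isClosed_cthickening)
    (fun k => hMcv.inter (hNcv.cthickening _))
    (hMb.subset Set.inter_subset_left)
  refine ⟨w, ?_⟩
  rw [proximalSet_eq_inter_cthickening hNb hNcl hNcv, cthickening_eq_iInter_cthickening]
  refine ⟨(hw 0).1, Set.mem_iInter₂.2 fun R hR => ?_⟩
  obtain ⟨k, hk⟩ := exists_nat_one_div_lt (sub_pos.2 hR)
  exact cthickening_mono (by linarith) N (hw k).2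

end Proximal

/-! ### Fixed points of relatively nonexpansive maps and the Ishikawa iteration -/

section Ishikawa

variable {X : Type*} [NormedAddCommGroup X] [NormedSpace ℝ X] {M N : Set X} {F : X → X}

/-- The asymptotic centre in `N` of an orbit in `M` is a fixed point. -/
theorem RelativelyNonexpansive.exists_fixedPoint [UniformConvexSpace X] [CompleteSpace X]
    (hF : RelativelyNonexpansive F M N) (hMne : M.Nonempty) (hMb : Bornology.IsBounded M)
    (hFM : Set.MapsTo F M M) (hNne : N.Nonempty) (hNcl : IsClosed N) (hNcv : Convex ℝ N)
    (hFN : Set.MapsTo F N N) : ∃ q ∈ N, F q = q := by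
  obtain ⟨w, hw⟩ := hMne
  have horb : ∀ n, F^[n] w ∈ M := fun n => hFM.iterate n hw
  obtain ⟨r, c, hc, hcr, huniq⟩ := exists_asymptotic_center hNne hNcl hNcv
    (x := fun n => F^[n] w) (hMb.subset (Set.range_subset_iff.2 horb))
  refine ⟨c, hc, huniq _ (hFN hc) fun s hs => ?_⟩
  rw [← map_add_atTop_eq_nat 1, eventually_map]
  filter_upwards [hcr s hs] with n hn
  rw [Function.iterate_succ_apply', norm_sub_rev]
  rw [norm_sub_rev] at hn
  exact (hF _ (horb n) _ hc).trans hn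

theorem norm_combo_sub_le {t : ℝ} (h0 : 0 ≤ t) (h1 : t ≤ 1) (x y q : X) :
    ‖(1 - t) • x + t • y - q‖ ≤ (1 - t) * ‖x - q‖ + t * ‖y - q‖ := by
  have : (1 - t) • x + t • y - q = (1 - t) • (x - q) + t • (y - q) := by module
  rw [this]
  refine (norm_add_le _ _).trans_eq ?_
  rw [norm_smul_of_nonneg (by linarith), norm_smul_of_nonneg h0]

variable {η δ : ℕ → ℝ} {w₀ : X}

theorem ishikawaSeq_mem (hMcv : Convex ℝ M) (hFM : Set.MapsTo F M M)
    (hη : ∀ n, η n ∈ Set.Icc (0 : ℝ) 1) (hδ : ∀ n, δ n ∈ Set.Icc (0 : ℝ) 1) (hw₀ : w₀ ∈ M) :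
    ∀ n, ishikawaSeq F η δ w₀ n ∈ M
  | 0 => hw₀
  | n + 1 => by
    have ih := ishikawaSeq_mem hMcv hFM hη hδ hw₀ n
    have hy := hMcv ih (hFM ih) (sub_nonneg.2 (hδ n).2) (hδ n).1 (sub_add_cancel _ _)
    exact hMcv ih (hFM hy) (sub_nonneg.2 (hη n).2) (hη n).1 (sub_add_cancel _ _)

/-- The outer step of the iteration, measured from a fixed point `q ∈ N`: the new iterate is at
most as far as a convex combination of the old iterate and the intermediate point. -/
theorem norm_ishikawaSeq_succ_sub_le (hF : RelativelyNonexpansive F M N) (hMcv : Convex ℝ M)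
    (hFM : Set.MapsTo F M M) (hη : ∀ n, η n ∈ Set.Icc (0 : ℝ) 1)
    (hδ : ∀ n, δ n ∈ Set.Icc (0 : ℝ) 1) (hw₀ : w₀ ∈ M) {q : X} (hq : q ∈ N) (hFq : F q = q)
    (n : ℕ) :
    ‖ishikawaSeq F η δ w₀ (n + 1) - q‖ ≤ (1 - η n) * ‖ishikawaSeq F η δ w₀ n - q‖ +
      η n * ‖(1 - δ n) • ishikawaSeq F η δ w₀ n + δ n • F (ishikawaSeq F η δ w₀ n) - q‖ := by
  have hw := ishikawaSeq_mem hMcv hFM hη hδ hw₀ n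
  have hy := hMcv hw (hFM hw) (sub_nonneg.2 (hδ n).2) (hδ n).1 (sub_add_cancel _ _)
  have h := hF _ hy q hq
  rw [hFq] at h
  exact (norm_combo_sub_le (hη n).1 (hη n).2 _ _ _).trans
    (by have := mul_le_mul_of_nonneg_left h (hη n).1; linarith)

theorem antitone_norm_ishikawaSeq_sub (hF : RelativelyNonexpansive F M N) (hMcv : Convex ℝ M)
    (hFM : Set.MapsTo F M M) (hη : ∀ n, η n ∈ Set.Icc (0 : ℝ) 1)
    (hδ : ∀ n, δ n ∈ Set.Icc (0 : ℝ) 1) (hw₀ : w₀ ∈ M) {q : X} (hq : q ∈ N) (hFq : F q = q) :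
    Antitone fun n => ‖ishikawaSeq F η δ w₀ n - q‖ := by
  refine antitone_nat_of_succ_le fun n => ?_
  have hw := ishikawaSeq_mem hMcv hFM hη hδ hw₀ n
  have h1 := norm_ishikawaSeq_succ_sub_le hF hMcv hFM hη hδ hw₀ hq hFq n
  have h2 := norm_combo_sub_le (hδ n).1 (hδ n).2 (ishikawaSeq F η δ w₀ n)
    (F (ishikawaSeq F η δ w₀ n)) q
  have h3 := hF _ hw q hq
  rw [hFq] at h3
  have h4 := mul_le_mul_of_nonneg_left h3 (hδ n).1
  have h5 := mul_le_mul_of_nonneg_left (h2.trans (add_le_add_right h4 _)) (hη n).1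
  linarith

/-- Asymptotic regularity of the Ishikawa iteration, given a fixed point in `N`. -/
theorem tendsto_norm_ishikawaSeq_sub_map [UniformConvexSpace X]
    (hF : RelativelyNonexpansive F M N) (hMcv : Convex ℝ M) (hFM : Set.MapsTo F M M)
    {ε : ℝ} (hε : 0 < ε) (hη : ∀ n, η n ∈ Set.Icc ε (1 - ε)) (hδ : ∀ n, δ n ∈ Set.Icc ε (1 - ε))
    (hw₀ : w₀ ∈ M) {q : X} (hq : q ∈ N) (hFq : F q = q) :
    Tendsto (fun n => ‖ishikawaSeq F η δ w₀ n - F (ishikawaSeq F η δ w₀ n)‖) atTop (𝓝 0) := by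
  have hsub : Set.Icc ε (1 - ε) ⊆ Set.Icc 0 1 := Set.Icc_subset_Icc hε.le (by linarith)
  have hη' := fun n => hsub (hη n)
  have hδ' := fun n => hsub (hδ n)
  have hanti := antitone_norm_ishikawaSeq_sub hF hMcv hFM hη' hδ' hw₀ hq hFq
  have hbdd : BddBelow (Set.range fun n => ‖ishikawaSeq F η δ w₀ n - q‖) :=
    ⟨0, by rintro _ ⟨n, rfl⟩; exact norm_nonneg _⟩
  have hlim := tendsto_atTop_ciInf hanti hbdd
  have hle := fun n => ciInf_le hbdd n
  set r := ⨅ n, ‖ishikawaSeq F η δ w₀ n - q‖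
  have hr : 0 ≤ r := Real.iInf_nonneg fun n => norm_nonneg _
  refine tendsto_order.2 ⟨fun e he => Eventually.of_forall fun n => he.trans_le (norm_nonneg _),
    fun e he => ?_⟩
  obtain ⟨s, hs, h⟩ := exists_pos_dist_lt_of_lt_norm_combo_sub (X := X) hr hε he
  -- The factor `ε` compensates the division by `η n ≥ ε` in the lower bound for the distance
  -- from the intermediate point to `q`.
  have hclose : ∀ᶠ n in atTop, ‖ishikawaSeq F η δ w₀ n - q‖ < r + ε * s :=
    hlim.eventually_lt_const (by have := mul_pos hε hs; linarith)
  filter_upwards [hclose] with n hn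
  have hw := ishikawaSeq_mem hMcv hFM hη' hδ' hw₀ n
  have hFw := hF _ hw q hq
  rw [hFq] at hFw
  have h1 := norm_ishikawaSeq_succ_sub_le hF hMcv hFM hη' hδ' hw₀ hq hFq n
  have h2 := hle (n + 1)
  have hηn := hη n
  rw [Set.mem_Icc] at hηn
  have hεs : ε * s ≤ s := mul_le_of_le_one_left hs.le (by linarith)
  rw [← dist_eq_norm]
  refine h q _ _ (δ n) (hδ n).1 (hδ n).2 (by linarith) (by linarith) ?_
  by_contra! hcon
  have hη0 : 0 < η n := by linarith
  have h3 := mul_le_mul_of_nonneg_left hcon hη0.le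
  have h4 := mul_lt_mul_of_pos_left hn (show 0 < 1 - η n by linarith)
  have h5 : ε * s ≤ η n * s := mul_le_mul_of_nonneg_right hηn.1 hs.le
  have h6 : 0 ≤ η n * (ε * s) := by positivity
  nlinarith

/-- A cluster point `p` of the iteration that lies in the proximal set is a fixed point, and the
whole sequence converges to it. -/
theorem ishikawaSeq_tendsto_of_subseq_tendsto [UniformConvexSpace X]
    (hF : RelativelyNonexpansive F M N) (hMcv : Convex ℝ M) (hNcv : Convex ℝ N)
    (hFM : Set.MapsTo F M M) (hFN : Set.MapsTo F N N)
    (hη : ∀ n, η n ∈ Set.Icc (0 : ℝ) 1) (hδ : ∀ n, δ n ∈ Set.Icc (0 : ℝ) 1) (hw₀ : w₀ ∈ M)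
    (hreg : Tendsto (fun n => ‖ishikawaSeq F η δ w₀ n - F (ishikawaSeq F η δ w₀ n)‖)
      atTop (𝓝 0))
    {p : X} (hp : p ∈ proximalSet M N) {φ : ℕ → ℕ} (hφ : StrictMono φ)
    (hφp : Tendsto (fun k => ishikawaSeq F η δ w₀ (φ k)) atTop (𝓝 p)) :
    F p = p ∧ Tendsto (ishikawaSeq F η δ w₀) atTop (𝓝 p) := by
  obtain ⟨hpM, p', hp', hpp'⟩ := hp
  have hd := setGap_nonneg M N
  have hmem := ishikawaSeq_mem hMcv hFM hη hδ hw₀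
  have hFφp : Tendsto (fun k => F (ishikawaSeq F η δ w₀ (φ k))) atTop (𝓝 p) := by
    have h0 := tendsto_zero_iff_norm_tendsto_zero.2 (hreg.comp hφ.tendsto_atTop)
    simpa using hφp.sub h0
  have hgap : Tendsto (fun k => ‖ishikawaSeq F η δ w₀ (φ k) - p'‖) atTop (𝓝 (setGap M N)) := by
    rw [← hpp']
    exact (hφp.sub_const p').norm
  have hFp' : F p' = p' := by
    refine hNcv.eq_of_norm_sub_le (p := p) hd (hFN hp') hp' ?_ ?_ fun x hx => ?_
    · rw [norm_sub_rev]
      exact le_of_tendsto_of_tendsto' (hFφp.sub_const (F p')).norm hgap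
        fun k => hF _ (hmem _) p' hp'
    · rw [norm_sub_rev, hpp']
    · rw [norm_sub_rev]
      exact setGap_le hpM hx
  have hFp : F p = p := by
    refine hMcv.eq_of_norm_sub_le (p := p') hd (hFM hpM) hpM ?_ hpp'.le
      fun x hx => setGap_le hx hp'
    have := hF p hpM p' hp'
    rwa [hFp', hpp'] at this
  refine ⟨hFp, ?_⟩
  have hlim : Tendsto (fun n => ‖ishikawaSeq F η δ w₀ n - p'‖) atTop (𝓝 (setGap M N)) :=
    tendsto_iff_tendsto_subseq_of_antitone
      (antitone_norm_ishikawaSeq_sub hF hMcv hFM hη hδ hw₀ hp' hFp') hφ.tendsto_atTop |>.2 hgap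
  refine Metric.tendsto_nhds.2 fun e he => ?_
  obtain ⟨s, hs, h⟩ := exists_pos_dist_lt_of_lt_norm_midpoint_sub (X := X) hd he
  filter_upwards [hlim.eventually_lt_const (show setGap M N < setGap M N + s by linarith)]
    with n hn
  have hmid := setGap_le (hMcv.midpoint_mem (hmem n) hpM) hp'
  exact h p' _ _ hn.le (by linarith) (by linarith)

end Ishikawa

theorem theorem2p1 {X : Type*} [NormedAddCommGroup X] [NormedSpace ℝ X] [CompleteSpace X]
    [UniformConvexSpace X] (M N : Set X)
    (hMne : M.Nonempty) (hNne : N.Nonempty)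
    (hMb : Bornology.IsBounded M) (hNb : Bornology.IsBounded N)
    (hMcl : IsClosed M) (hNcl : IsClosed N)
    (hMcv : Convex ℝ M) (hNcv : Convex ℝ N)
    (F : X → X) (hFM : Set.MapsTo F M M) (hFN : Set.MapsTo F N N)
    (hF : RelativelyNonexpansive F M N)
    (ε : ℝ) (hε : ε ∈ Set.Ioo (0 : ℝ) (1 / 2))
    (η δ : ℕ → ℝ) (hη : ∀ n, η n ∈ Set.Ioo ε (1 - ε)) (hδ : ∀ n, δ n ∈ Set.Ioo ε (1 - ε))
    (w₀ : X) (hw₀ : w₀ ∈ M)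
    (hdist : Filter.Tendsto
      (fun n => Metric.infDist (ishikawaSeq F η δ w₀ n) (proximalSet M N)) Filter.atTop (nhds 0)) :
    Filter.Tendsto (fun n => ‖ishikawaSeq F η δ w₀ n - F (ishikawaSeq F η δ w₀ n)‖)
        Filter.atTop (nhds 0) ∧
      ((∃ K : Set X, IsCompact K ∧ F '' M ⊆ K) →
        ∃ p ∈ M, F p = p ∧
          Filter.Tendsto (ishikawaSeq F η δ w₀) Filter.atTop (nhds p)) := by
  have hsub : Set.Ioo ε (1 - ε) ⊆ Set.Icc 0 1 :=
    Set.Ioo_subset_Icc_self.trans (Set.Icc_subset_Icc hε.1.le (by linarith [hε.1]))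
  have hη' := fun n => hsub (hη n)
  have hδ' := fun n => hsub (hδ n)
  obtain ⟨q, hq, hFq⟩ := hF.exists_fixedPoint hMne hMb hFM hNne hNcl hNcv hFN
  have hreg := tendsto_norm_ishikawaSeq_sub_map hF hMcv hFM hε.1
    (fun n => Set.Ioo_subset_Icc_self (hη n)) (fun n => Set.Ioo_subset_Icc_self (hδ n)) hw₀ hq hFq
  refine ⟨hreg, ?_⟩
  rintro ⟨K, hK, hFK⟩
  have hmem := ishikawaSeq_mem hMcv hFM hη' hδ' hw₀
  obtain ⟨p, -, φ, hφ, hφp⟩ := hK.tendsto_subseq fun n => hFK (Set.mem_image_of_mem F (hmem n))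
  have hwp : Filter.Tendsto (fun k => ishikawaSeq F η δ w₀ (φ k)) Filter.atTop (nhds p) := by
    have h0 := tendsto_zero_iff_norm_tendsto_zero.2 (hreg.comp hφ.tendsto_atTop)
    simpa using h0.add hφp
  have hp : p ∈ proximalSet M N := by
    -- Nonemptiness matters here: the distance to the empty set is `0` by convention.
    rw [(isClosed_proximalSet hMcl hNb hNcl hNcv).mem_iff_infDist_zero
      (proximalSet_nonempty hMne hNne hMb hNb hMcl hNcl hMcv hNcv)]
    exact tendsto_nhds_unique
      (((Metric.continuous_infDist_pt _).tendsto p).comp hwp) (hdist.comp hφ.tendsto_atTop)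
  obtain ⟨hFp, hlim⟩ := ishikawaSeq_tendsto_of_subseq_tendsto hF hMcv hNcv hFM hFN hη' hδ' hw₀
    hreg hp hφ hwp
  exact ⟨p, hp.1, hFp, hlim⟩
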